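/- Let $X$ be a Polish space, let $\Omega=C([0,1],X)$ be the space of continuous paths with the topology of uniform convergence and its Borel $\sigma$-field, and write $Q_t$ for the law of $\omega\mapsto\omega(t)$ under a measure $Q$ on $\Omega$. Let $R$ be a (possibly infinite) Borel measure on $\Omega$ such that $R_t$ is $\sigma$-finite for every $t\in[0,1]$. For a Borel probability measure $P$ on $\Omega$ the relative entropy $H(P|R)=E_P[\log\frac{dP}{dR}]\in(-\infty,+\infty]$ is defined by $$H(P|R):=H(P|R_W)-\int_\Omega W\,dP-\log z_W,\qquad R_W:=z_W^{-1}e^{-W}R,\qquad z_W:=\int_\Omega e^{-W}\,dR,$$ where $W:\Omega\to[0,\infty)$ is any measurable function with $z_W<\infty$ and $\int W\,dP<\infty$ (the value does not depend on $W$; here $H(P|R_W)$ is the usual relative entropy with respect to a probability measure, equal to $+\infty$ if $P\not\ll R_W$). If there is no such $W$, then $H(P|R)$ is undefined, and such a $P$ is not compared with in the minimisation below. Let $\mathcal T\subset[0,1]$ be any set and let $(\mu_t)_{t\in\mathcal T}$ be Borel probability measures on $X$. A competitor is a Borel probability measure $P$ on $\Omega$ with $P_t=\mu_t$ for all $t\in\mathcal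 T$. A solution of the extended Schrödinger problem $$H(P|R)\to\min;\qquad P_t=\mu_t\quad\text{for all } t\in\mathcal T$$ is a competitor $P$ with $H(P|R)<\infty$ and $H(P|R)\le H(P'|R)$ for all competitors $P'$ for which $H(P'|R)$ is defined. Proposition. (1) Assume that there is a measurable $W:\Omega\to[0,\infty)$ with $\int e^{-W}\,dR<\infty$ which is uniformly integrable over the competitors $P\ll R$, that is, for every $\varepsilon>0$ there is $K\ge 0$ with $\int_{\{W\ge K\}}W\,dP\le\varepsilon$ for every competitor $P\ll R$. (If $R$ is finite, $W=0$ always has this property.) Then the extended Schrödinger problem has a solution if and only if there is a competitor $Q$ with $H(Q|R)<\infty$. (2) Without that assumption on $W$, the extended Schrödinger problem has at most one solution. -/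

import Mathlib

open MeasureTheory InformationTheory
open scoped ENNReal NNReal

noncomputable section

/-! ### Relative entropy with respect to a possibly unbounded measure -/

section Entropy

variable {Ω : Type*} [MeasurableSpace Ω]

/-- `W : Ω → [0, ∞)` is measurable and `z_W = ∫ e^{-W} dR < ∞`. -/
structure IsEntropyWeight (R : Measure Ω) (W : Ω → ℝ≥0) : Prop where
  measurable : Measurable W
  integrable : Integrable (fun ω => Real.exp (-(W ω : ℝ))) R

/-- The number `H(P | R_W) - ∫ W dP - log z_W`, where `z_W = ∫ e^{-W} dR` and
`R_W = z_W⁻¹ e^{-W} R` (this is `R.tilted (-W)`). -/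
def entropyWith (R : Measure Ω) (W : Ω → ℝ≥0) (P : ProbabilityMeasure Ω) : EReal :=
  (klDiv (P : Measure Ω) (R.tilted fun ω => -(W ω : ℝ)) : EReal)
    - ((∫ ω, (W ω : ℝ) ∂(P : Measure Ω) : ℝ) : EReal)
    - ((Real.log (∫ ω, Real.exp (-(W ω : ℝ)) ∂ R) : ℝ) : EReal)

open scoped Classical in
/-- The relative entropy `H(P | R) ∈ (-∞, ∞]` of a probability measure `P` with respect to a
measure `R`. It is computed with any weight `W` such that `∫ e^{-W} dR < ∞` and `∫ W dP < ∞`; by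
`relEntropy_eq_entropyWith` the value does not depend on that weight. When there is no
such weight, `H(P | R)` is not defined, and the function below has the default value `+∞`. -/
def relEntropy (P : ProbabilityMeasure Ω) (R : Measure Ω) : EReal :=
  if h : ∃ W, IsEntropyWeight R W ∧ ∫⁻ ω, (W ω : ℝ≥0∞) ∂(P : Measure Ω) < ∞ then
    entropyWith R h.choose P
  else ⊤

open scoped Classical in
/-- For an admissible weight, `entropyWith` is `E_P[log (dP/dR)]`. -/
theorem entropyWith_eq (R : Measure Ω) [SigmaFinite R] (P : ProbabilityMeasure Ω) {W : Ω → ℝ≥0}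
    (hW : IsEntropyWeight R W) (hWP : ∫⁻ ω, (W ω : ℝ≥0∞) ∂(P : Measure Ω) < ∞) :
    entropyWith R W P =
      if (P : Measure Ω) ≪ R ∧ Integrable (llr (P : Measure Ω) R) (P : Measure Ω)
      then ((∫ ω, llr (P : Measure Ω) R ω ∂(P : Measure Ω) : ℝ) : EReal) else ⊤ := by
  have hWi : Integrable (fun ω => (W ω : ℝ)) (P : Measure Ω) := by
    refine ⟨hW.measurable.coe_nnreal_real.aestronglyMeasurable, ?_⟩
    simpa [HasFiniteIntegral, enorm] using hWP
  have hWn : Integrable (fun ω => -(W ω : ℝ)) (P : Measure Ω) := hWi.neg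
  unfold entropyWith
  by_cases hac : (P : Measure Ω) ≪ R
  · have hac' : (P : Measure Ω) ≪ R.tilted fun ω => -(W ω : ℝ) :=
      hac.trans (absolutelyContinuous_tilted hW.integrable)
    have hR : NeZero R := ⟨by
      rintro rfl
      exact IsProbabilityMeasure.ne_zero (P : Measure Ω) (Measure.absolutelyContinuous_zero_iff.1 hac)⟩
    have hprob := isProbabilityMeasure_tilted hW.integrable
    by_cases hint : Integrable (llr (P : Measure Ω) R) (P : Measure Ω)
    · have hint' := integrable_llr_tilted_right hac hWn hint hW.integrable
      have hk : 0 ≤ ∫ ω, llr (P : Measure Ω) (R.tilted fun ω => -(W ω : ℝ)) ω ∂(P : Measure Ω) := by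
        have := integral_llr_add_sub_measure_univ_nonneg hac' hint'
        simpa using this
      rw [if_pos ⟨hac, hint⟩, klDiv_of_ac_of_integrable hac' hint']
      simp only [probReal_univ, add_sub_cancel_right]
      rw [EReal.coe_ennreal_ofReal, max_eq_left hk,
        integral_llr_tilted_right hac hWn hW.integrable hint, integral_neg,
        ← EReal.coe_sub, ← EReal.coe_sub]
      congr 1
      ring
    · have hint' : ¬ Integrable (llr (P : Measure Ω) (R.tilted fun ω => -(W ω : ℝ)))
          (P : Measure Ω) := by
        intro h
        apply hint
        rw [integrable_congr (llr_tilted_right hac hW.integrable)] at h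
        have h2 := h.sub (hWn.neg.add (integrable_const
          (Real.log (∫ ω, Real.exp (-(W ω : ℝ)) ∂ R))))
        refine h2.congr (Filter.Eventually.of_forall fun ω => ?_)
        simp
      rw [if_neg (by tauto), klDiv_of_not_integrable hint']
      simp
  · have hac' : ¬ (P : Measure Ω) ≪ R.tilted fun ω => -(W ω : ℝ) :=
      fun h => hac (h.trans (tilted_absolutelyContinuous R _))
    rw [if_neg (by tauto), klDiv_of_not_ac hac']
    simp

/-- The relative entropy can be computed with any admissible weight. -/
theorem relEntropy_eq_entropyWith (R : Measure Ω) [SigmaFinite R] (P : ProbabilityMeasure Ω)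
    {W : Ω → ℝ≥0} (hW : IsEntropyWeight R W)
    (hWP : ∫⁻ ω, (W ω : ℝ≥0∞) ∂(P : Measure Ω) < ∞) :
    relEntropy P R = entropyWith R W P := by
  have h : ∃ W, IsEntropyWeight R W ∧ ∫⁻ ω, (W ω : ℝ≥0∞) ∂(P : Measure Ω) < ∞ := ⟨W, hW, hWP⟩
  rw [relEntropy, dif_pos h, entropyWith_eq R P h.choose_spec.1 h.choose_spec.2,
    entropyWith_eq R P hW hWP]

/-- `W` is uniformly integrable with respect to all the probability measures in `S`. -/
def UniformlyIntegrableOver (W : Ω → ℝ≥0) (S : Set (ProbabilityMeasure Ω)) : Prop :=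
  ∀ ε : ℝ≥0, 0 < ε → ∃ K : ℝ≥0, ∀ P ∈ S,
    ∫⁻ ω in {ω | K ≤ W ω}, (W ω : ℝ≥0∞) ∂(P : Measure Ω) ≤ ε

end Entropy

/-! ### Path measures and the extended Schrödinger problem -/

/-- The space of continuous paths from `[0,1]` to `X`, with the topology of uniform convergence. -/
abbrev PathSpace (X : Type*) [TopologicalSpace X] : Type _ := C(unitInterval, X)

instance PathSpace.measurableSpace (X : Type*) [TopologicalSpace X] :
    MeasurableSpace (PathSpace X) := borel _

instance PathSpace.borelSpace (X : Type*) [TopologicalSpace X] : BorelSpace (PathSpace X) := ⟨rfl⟩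

section Schrodinger

variable {X : Type*} [TopologicalSpace X] [MeasurableSpace X]

/-- The time marginal `Q_t`: the law of the canonical process `X_t(ω) = ω t` under `Q`. -/
def timeMarginal (Q : Measure (PathSpace X)) (t : unitInterval) : Measure X :=
  Q.map fun ω => ω t

/-- `Q` is conditionable: all its time marginals are σ-finite. -/
def IsConditionable (Q : Measure (PathSpace X)) : Prop :=
  ∀ t : unitInterval, SigmaFinite (timeMarginal Q t)

/-- The competitors: path probability measures with `P_t = μ_t` for all `t ∈ T`. -/
def competitors (T : Set unitInterval) (μ : T → ProbabilityMeasure X) :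
    Set (ProbabilityMeasure (PathSpace X)) :=
  {P | ∀ t : T, timeMarginal (P : Measure (PathSpace X)) t = (μ t : Measure X)}

/-- `P` is a solution of the extended Schrödinger problem: a competitor of finite relative entropy
which has the least relative entropy among all competitors. -/
structure IsSchrodingerSolution (R : Measure (PathSpace X)) (T : Set unitInterval)
    (μ : T → ProbabilityMeasure X) (P : ProbabilityMeasure (PathSpace X)) : Prop where
  mem : P ∈ competitors T μ
  lt_top : relEntropy P R < ⊤
  le : ∀ P' ∈ competitors T μ, relEntropy P R ≤ relEntropy P' R

end Schrodinger

end

/-!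
The argument is Csiszár's construction of the `I`-projection; it uses no compactness of the set of
competitors. Fix a weight `W`, put `ν = R_W = z_W⁻¹ e^{-W} R`, and describe measures of finite
entropy by their densities with respect to the probability measure `ν`.

In `H(P | R) = klDiv P ν - ∫ W dP - log z_W` the last two terms are affine in `P`, so the midpoint
convexity defect `H(P) + H(Q) - 2 H((P + Q) / 2)` is that of `klDiv · ν`. It controls the `L¹`
distance of the densities: for every `s > 0`,
`‖dP/dν - dQ/dν‖₁ ≤ (2 / s) (H(P) + H(Q) - 2 H((P + Q) / 2)) + s`
(`HasFiniteEntropyWith.eLpNorm_rnDensity_sub_le`). This is the integral of an elementary pointwise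
inequality for `x log x`, `abs_sub_add_klFun_midpoint_le`.

Uniqueness: two solutions may have their entropies defined through different weights, but the
minimum of these weights serves both and their midpoint. The midpoint is a competitor, so the
defect is nonpositive, and letting `s → 0` shows that the two densities agree
(`eq_of_relEntropy_le_relEntropy_halfSum`).

Existence: uniform integrability bounds `∫ W dP`, so the infimum is finite. Midpoints of competitors
are competitors, hence the estimate makes minimizing sequences Cauchy in `L¹(ν)`. Measures converge
setwise along the sequence, so the limit has the prescribed marginals. Fatou's lemma makes
`klDiv · ν` lower semicontinuous and uniform integrability makes `∫ W dP` upper semicontinuous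
along the sequence; hence the limit attains the infimum (`exists_relEntropy_minimizer`).
-/

noncomputable section

/-! ### A quantitative convexity estimate for `klFun` -/

section KLFun

/-- A lower bound for `x log (x / m)` in terms of square roots, a form of
`log t ≤ t - 1` at `t = √(m / x)`. -/
theorem two_mul_sub_sqrt_mul_sqrt_le_mul_log_sub {x m : ℝ} (hx : 0 ≤ x) (hm : 0 < m) :
    2 * (x - √x * √m) ≤ x * Real.log x - x * Real.log m := by
  rcases hx.eq_or_lt with rfl | hx
  · simp
  have h := Real.log_le_sub_one_of_pos (div_pos (Real.sqrt_pos.2 hm) (Real.sqrt_pos.2 hx))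
  rw [Real.log_div (Real.sqrt_pos.2 hm).ne' (Real.sqrt_pos.2 hx).ne', Real.log_sqrt hm.le,
    Real.log_sqrt hx.le] at h
  have h2 : x * (√m / √x) = √x * √m := by
    have : √x ≠ 0 := (Real.sqrt_pos.2 hx).ne'
    field_simp
    rw [Real.sq_sqrt hx.le]
  nlinarith [mul_le_mul_of_nonneg_left h hx.le]

/-- The midpoint convexity defect of `klFun` dominates a squared Hellinger distance. -/
theorem sq_sqrt_sub_sqrt_le_klFun {a b : ℝ} (ha : 0 ≤ a) (hb : 0 ≤ b) :
    (√a - √b) ^ 2 ≤ 2 * (klFun a + klFun b - 2 * klFun ((a + b) / 2)) := by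
  rcases (add_nonneg ha hb).eq_or_lt with h0 | h0
  · obtain rfl : a = 0 := by linarith
    obtain rfl : b = 0 := by linarith
    simp [two_mul]
  have hm : 0 < (a + b) / 2 := by linarith
  have h1 := two_mul_sub_sqrt_mul_sqrt_le_mul_log_sub ha hm
  have h2 := two_mul_sub_sqrt_mul_sqrt_le_mul_log_sub hb hm
  simp only [klFun_apply]
  -- With `m = (a + b) / 2` the defect is at least `(√a - √m)² + (√b - √m)²`; the parallelogram law
  -- bounds this below by `(√a - √b)² / 2`.
  nlinarith [sq_nonneg (√a + √b - 2 * √((a + b) / 2)), Real.sq_sqrt ha, Real.sq_sqrt hb,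
    Real.sq_sqrt hm.le]

/-- A pointwise form of Pinsker's inequality for the midpoint convexity defect of `klFun`. The
free parameter `s` takes the place of a later application of the Cauchy-Schwarz inequality. -/
theorem abs_sub_add_klFun_midpoint_le {a b s : ℝ} (ha : 0 ≤ a) (hb : 0 ≤ b) (hs : 0 < s) :
    |a - b| + 4 / s * klFun ((a + b) / 2) ≤
      2 / s * (klFun a + klFun b) + s / 2 * (a + b) := by
  have h := sq_sqrt_sub_sqrt_le_klFun ha hb
  have hab : |a - b| = |√a - √b| * (√a + √b) := by
    rw [← abs_of_nonneg (add_nonneg (Real.sqrt_nonneg a) (Real.sqrt_nonneg b)), ← abs_mul]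
    congr 1
    nlinarith [Real.sq_sqrt ha, Real.sq_sqrt hb]
  have h1 : s * |a - b| ≤ (√a - √b) ^ 2 + s ^ 2 / 2 * (a + b) := by
    rw [hab, ← sq_abs (√a - √b)]
    nlinarith [sq_nonneg (|√a - √b| - s / 2 * (√a + √b)), Real.sq_sqrt ha, Real.sq_sqrt hb,
      mul_nonneg (sq_nonneg s) (sq_nonneg (√a - √b))]
  rw [← mul_le_mul_iff_right₀ hs]
  have e1 : s * (|a - b| + 4 / s * klFun ((a + b) / 2)) =
      s * |a - b| + 4 * klFun ((a + b) / 2) := by field_simp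
  have e2 : s * (2 / s * (klFun a + klFun b) + s / 2 * (a + b)) =
      2 * (klFun a + klFun b) + s ^ 2 / 2 * (a + b) := by field_simp
  rw [e1, e2]
  linarith

end KLFun

/-! ### Densities of probability measures and their `L¹` distance -/

section Density

variable {Ω : Type*} [MeasurableSpace Ω]

/-- The real-valued density of `P` with respect to `ν`. -/
def rnDensity (P ν : Measure Ω) (ω : Ω) : ℝ := (P.rnDeriv ν ω).toReal

theorem measurable_rnDensity (P ν : Measure Ω) : Measurable (rnDensity P ν) :=
  (Measure.measurable_rnDeriv P ν).ennreal_toReal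

theorem rnDensity_nonneg (P ν : Measure Ω) (ω : Ω) : 0 ≤ rnDensity P ν ω := ENNReal.toReal_nonneg

theorem ofReal_rnDensity (P ν : Measure Ω) [SigmaFinite P] :
    (fun ω => ENNReal.ofReal (rnDensity P ν ω)) =ᵐ[ν] P.rnDeriv ν := by
  filter_upwards [P.rnDeriv_ne_top ν] with ω h
  exact ENNReal.ofReal_toReal h

theorem memLp_one_rnDensity (P ν : Measure Ω) [IsFiniteMeasure P] : MemLp (rnDensity P ν) 1 ν :=
  memLp_one_iff_integrable.2 Measure.integrable_toReal_rnDeriv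

/-- The integral of a bounded function varies by at most the bound times the `L¹` distance of the
densities. -/
theorem lintegral_le_add_mul_eLpNorm_rnDensity_sub {P Q ν : Measure Ω} [IsFiniteMeasure P]
    [IsFiniteMeasure Q] [SigmaFinite ν] (hP : P ≪ ν) (hQ : Q ≪ ν) {h : Ω → ℝ≥0∞}
    (hh : Measurable h) {K : ℝ≥0∞} (hK : ∀ ω, h ω ≤ K) :
    ∫⁻ ω, h ω ∂P ≤
      ∫⁻ ω, h ω ∂Q + K * eLpNorm (rnDensity P ν - rnDensity Q ν) 1 ν := by
  have hm : Measurable fun ω => ‖rnDensity P ν ω - rnDensity Q ν ω‖ₑ :=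
    ((measurable_rnDensity P ν).sub (measurable_rnDensity Q ν)).enorm
  rw [← lintegral_rnDeriv_mul hP hh.aemeasurable, ← lintegral_rnDeriv_mul hQ hh.aemeasurable,
    eLpNorm_one_eq_lintegral_enorm, ← lintegral_const_mul K (by simpa using hm),
    ← lintegral_add_left (f := fun ω => Q.rnDeriv ν ω * h ω)
      ((Measure.measurable_rnDeriv Q ν).mul hh)]
  refine lintegral_mono_ae ?_
  filter_upwards [ofReal_rnDensity P ν, ofReal_rnDensity Q ν] with ω h1 h2
  rw [← h1, ← h2]
  have h3 : ENNReal.ofReal (rnDensity P ν ω) ≤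
      ENNReal.ofReal (rnDensity Q ν ω) + ‖rnDensity P ν ω - rnDensity Q ν ω‖ₑ := by
    rw [Real.enorm_eq_ofReal_abs, ← ENNReal.ofReal_add (rnDensity_nonneg _ _ _) (abs_nonneg _)]
    exact ENNReal.ofReal_le_ofReal (by linarith [le_abs_self (rnDensity P ν ω - rnDensity Q ν ω)])
  calc _ ≤ (ENNReal.ofReal (rnDensity Q ν ω) + ‖rnDensity P ν ω - rnDensity Q ν ω‖ₑ) * h ω := by
        gcongr
    _ = ENNReal.ofReal (rnDensity Q ν ω) * h ω + h ω * ‖rnDensity P ν ω - rnDensity Q ν ω‖ₑ := by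
        ring
    _ ≤ _ := by
        gcongr
        · exact hK ω
        · rfl

theorem measure_le_add_eLpNorm_rnDensity_sub {P Q ν : Measure Ω} [IsFiniteMeasure P]
    [IsFiniteMeasure Q] [SigmaFinite ν] (hP : P ≪ ν) (hQ : Q ≪ ν) {A : Set Ω}
    (hA : MeasurableSet A) :
    P A ≤ Q A + eLpNorm (rnDensity P ν - rnDensity Q ν) 1 ν := by
  have h := lintegral_le_add_mul_eLpNorm_rnDensity_sub hP hQ
    (measurable_one.indicator hA) (K := 1) (fun ω => Set.indicator_le_self' (by simp) ω)
  simpa [lintegral_indicator_one hA] using h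

/-- Convergence of densities in `L¹` implies setwise convergence of the measures. -/
theorem tendsto_measure_of_tendsto_eLpNorm_rnDensity_sub {ν : Measure Ω} [SigmaFinite ν]
    {P : ℕ → Measure Ω} {Q : Measure Ω} [∀ n, IsFiniteMeasure (P n)] [IsFiniteMeasure Q]
    (hP : ∀ n, P n ≪ ν) (hQ : Q ≪ ν)
    (h : Filter.Tendsto (fun n => eLpNorm (rnDensity (P n) ν - rnDensity Q ν) 1 ν)
      Filter.atTop (nhds 0)) {A : Set Ω} (hA : MeasurableSet A) :
    Filter.Tendsto (fun n => P n A) Filter.atTop (nhds (Q A)) := by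
  refine tendsto_of_tendsto_of_tendsto_of_le_of_le
    (g := fun n => Q A - eLpNorm (rnDensity (P n) ν - rnDensity Q ν) 1 ν)
    (h := fun n => Q A + eLpNorm (rnDensity (P n) ν - rnDensity Q ν) 1 ν) ?_ ?_ ?_ ?_
  · simpa using ENNReal.Tendsto.sub (tendsto_const_nhds (x := Q A)) h
      (Or.inl (measure_ne_top Q A))
  · simpa using (tendsto_const_nhds (x := Q A)).add h
  · intro n
    rw [tsub_le_iff_right, eLpNorm_sub_comm]
    exact measure_le_add_eLpNorm_rnDensity_sub hQ (hP n) hA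
  · exact fun n => measure_le_add_eLpNorm_rnDensity_sub (hP n) hQ hA

/-- Probability measures that are absolutely continuous with respect to `ν` are complete for the
`L¹` distance of the densities. -/
theorem exists_tendsto_eLpNorm_rnDensity_sub {ν : Measure Ω} [SigmaFinite ν]
    {P : ℕ → ProbabilityMeasure Ω} (hP : ∀ n, (P n : Measure Ω) ≪ ν) {B : ℕ → ℝ≥0∞}
    (hB : ∑' i, B i ≠ ∞) (hcau : ∀ N n m : ℕ, N ≤ n → N ≤ m →
      eLpNorm (rnDensity (P n : Measure Ω) ν - rnDensity (P m : Measure Ω) ν) 1 ν < B N) :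
    ∃ Q : ProbabilityMeasure Ω, (Q : Measure Ω) ≪ ν ∧
      Filter.Tendsto
        (fun n => eLpNorm (rnDensity (P n : Measure Ω) ν - rnDensity (Q : Measure Ω) ν) 1 ν)
        Filter.atTop (nhds 0) := by
  obtain ⟨f, hf, hlim⟩ := Lp.cauchy_complete_eLpNorm (le_refl 1)
    (fun n => memLp_one_rnDensity (P n : Measure Ω) ν) hB hcau
  have hfi := memLp_one_iff_integrable.1 hf
  have hfin : IsFiniteMeasure (ν.withDensity fun ω => ENNReal.ofReal (f ω)) :=
    isFiniteMeasure_withDensity_ofReal hfi.2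
  have hac : ν.withDensity (fun ω => ENNReal.ofReal (f ω)) ≪ ν :=
    withDensity_absolutelyContinuous _ _
  have hlim' : Filter.Tendsto (fun n => eLpNorm (rnDensity (P n : Measure Ω) ν -
      rnDensity (ν.withDensity fun ω => ENNReal.ofReal (f ω)) ν) 1 ν) Filter.atTop (nhds 0) := by
    refine tendsto_of_tendsto_of_tendsto_of_le_of_le tendsto_const_nhds hlim (fun _ => zero_le)
      fun n => eLpNorm_mono_ae ?_
    filter_upwards [Measure.rnDeriv_withDensity₀ ν hf.1.aemeasurable.ennreal_ofReal] with ω hω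
    have h0 := rnDensity_nonneg (P n : Measure Ω) ν ω
    simp only [Pi.sub_apply, Real.norm_eq_abs]
    rw [rnDensity.eq_def (ν.withDensity _), hω, ENNReal.toReal_ofReal']
    -- Replacing the limit by its positive part does not increase the distance to a nonnegative
    -- function.
    rcases le_total 0 (f ω) with h | h
    · rw [max_eq_left h]
    · rw [max_eq_right h, sub_zero, abs_of_nonneg h0, abs_of_nonneg (by linarith)]
      linarith
  have huniv := tendsto_measure_of_tendsto_eLpNorm_rnDensity_sub hP hac hlim' MeasurableSet.univ
  simp only [measure_univ] at huniv
  exact ⟨⟨_, ⟨(tendsto_nhds_unique huniv tendsto_const_nhds)⟩⟩, hac, hlim'⟩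

end Density

/-! ### Lower semicontinuity and midpoint convexity of `klDiv` -/

section KLDiv

variable {Ω : Type*} [MeasurableSpace Ω]

/-- Sublevel sets of `klDiv · ν` are closed under `L¹` convergence of densities. -/
theorem klDiv_le_of_tendsto_eLpNorm_rnDensity_sub {ν : Measure Ω} [IsFiniteMeasure ν]
    {P : ℕ → Measure Ω} {Q : Measure Ω} [∀ n, IsFiniteMeasure (P n)] [IsFiniteMeasure Q]
    (hP : ∀ n, P n ≪ ν) (hQ : Q ≪ ν)
    (h : Filter.Tendsto (fun n => eLpNorm (rnDensity (P n) ν - rnDensity Q ν) 1 ν)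
      Filter.atTop (nhds 0)) {c : ℝ≥0∞} (hc : ∀ᶠ n in Filter.atTop, klDiv (P n) ν ≤ c) :
    klDiv Q ν ≤ c := by
  obtain ⟨ns, hns, hae⟩ := (tendstoInMeasure_of_tendsto_eLpNorm one_ne_zero
    (fun n => (measurable_rnDensity (P n) ν).aestronglyMeasurable)
    (measurable_rnDensity Q ν).aestronglyMeasurable h).exists_seq_tendsto_ae
  have hmeas : ∀ n, Measurable fun ω => ENNReal.ofReal (klFun (rnDensity (P n) ν ω)) :=
    fun n => (measurable_klFun.comp (measurable_rnDensity (P n) ν)).ennreal_ofReal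
  calc klDiv Q ν
      = ∫⁻ ω, Filter.liminf (fun i => ENNReal.ofReal (klFun (rnDensity (P (ns i)) ν ω)))
          Filter.atTop ∂ν := by
        rw [klDiv_eq_lintegral_klFun_of_ac hQ]
        refine lintegral_congr_ae ?_
        filter_upwards [hae] with ω hω
        exact ((ENNReal.continuous_ofReal.comp continuous_klFun).continuousAt.tendsto.comp
          hω).liminf_eq.symm
    _ ≤ Filter.liminf (fun i => ∫⁻ ω, ENNReal.ofReal (klFun (rnDensity (P (ns i)) ν ω)) ∂ν)
          Filter.atTop := lintegral_liminf_le fun i => hmeas (ns i)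
    _ = Filter.liminf (fun i => klDiv (P (ns i)) ν) Filter.atTop := by
        simp_rw [klDiv_eq_lintegral_klFun_of_ac (hP _)]
        rfl
    _ ≤ c := Filter.liminf_le_of_frequently_le' (hns.tendsto_atTop.eventually hc).frequently

/-- The midpoint `(P + Q) / 2` of two probability measures. -/
def halfSum (P Q : ProbabilityMeasure Ω) : ProbabilityMeasure Ω :=
  ⟨(2⁻¹ : ℝ≥0∞) • ((P : Measure Ω) + (Q : Measure Ω)), ⟨by
    simp [ENNReal.inv_two_add_inv_two]⟩⟩

theorem coe_halfSum (P Q : ProbabilityMeasure Ω) :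
    (halfSum P Q : Measure Ω) = (2⁻¹ : ℝ≥0∞) • ((P : Measure Ω) + (Q : Measure Ω)) := rfl

theorem halfSum_absolutelyContinuous {P Q : ProbabilityMeasure Ω} {ν : Measure Ω}
    (hP : (P : Measure Ω) ≪ ν) (hQ : (Q : Measure Ω) ≪ ν) : (halfSum P Q : Measure Ω) ≪ ν :=
  (Measure.AbsolutelyContinuous.add_left hP hQ).smul_left _

theorem rnDensity_halfSum (P Q : ProbabilityMeasure Ω) (ν : Measure Ω) [SigmaFinite ν] :
    rnDensity (halfSum P Q : Measure Ω) ν =ᵐ[ν]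
      fun ω => (rnDensity (P : Measure Ω) ν ω + rnDensity (Q : Measure Ω) ν ω) / 2 := by
  filter_upwards [Measure.rnDeriv_smul_left_of_ne_top ((P : Measure Ω) + (Q : Measure Ω)) ν
      (r := 2⁻¹) (by simp), Measure.rnDeriv_add (P : Measure Ω) (Q : Measure Ω) ν,
      (P : Measure Ω).rnDeriv_ne_top ν, (Q : Measure Ω).rnDeriv_ne_top ν] with ω h1 h2 h3 h4
  rw [rnDensity, coe_halfSum, h1, Pi.smul_apply, h2, Pi.add_apply, smul_eq_mul,
    ENNReal.toReal_mul, ENNReal.toReal_add h3 h4, rnDensity, rnDensity]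
  simp
  ring

theorem lintegral_ofReal_rnDensity (P : ProbabilityMeasure Ω) {ν : Measure Ω} [SigmaFinite ν]
    (hP : (P : Measure Ω) ≪ ν) :
    ∫⁻ ω, ENNReal.ofReal (rnDensity (P : Measure Ω) ν ω) ∂ν = 1 := by
  rw [lintegral_congr_ae (ofReal_rnDensity (P : Measure Ω) ν), Measure.lintegral_rnDeriv hP,
    measure_univ]

/-- The midpoint convexity defect of `klDiv · ν` controls the `L¹` distance. -/
theorem eLpNorm_rnDensity_sub_add_klDiv_halfSum_le {ν : Measure Ω} [IsFiniteMeasure ν]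
    {P Q : ProbabilityMeasure Ω} (hP : (P : Measure Ω) ≪ ν) (hQ : (Q : Measure Ω) ≪ ν)
    {s : ℝ} (hs : 0 < s) :
    eLpNorm (rnDensity (P : Measure Ω) ν - rnDensity (Q : Measure Ω) ν) 1 ν +
        ENNReal.ofReal (4 / s) * klDiv (halfSum P Q : Measure Ω) ν ≤
      ENNReal.ofReal (2 / s) * (klDiv (P : Measure Ω) ν + klDiv (Q : Measure Ω) ν) +
        ENNReal.ofReal s := by
  set p := rnDensity (P : Measure Ω) ν with hp
  set q := rnDensity (Q : Measure Ω) ν with hq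
  have hpm : Measurable p := measurable_rnDensity _ _
  have hqm : Measurable q := measurable_rnDensity _ _
  have hp0 : ∀ ω, 0 ≤ p ω := rnDensity_nonneg _ _
  have hq0 : ∀ ω, 0 ≤ q ω := rnDensity_nonneg _ _
  have hM : klDiv (halfSum P Q : Measure Ω) ν =
      ∫⁻ ω, ENNReal.ofReal (klFun ((p ω + q ω) / 2)) ∂ν := by
    rw [klDiv_eq_lintegral_klFun_of_ac (halfSum_absolutelyContinuous hP hQ)]
    refine lintegral_congr_ae ?_
    filter_upwards [rnDensity_halfSum P Q ν] with ω hω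
    rw [← hω, rnDensity]
  have hkP : klDiv (P : Measure Ω) ν = ∫⁻ ω, ENNReal.ofReal (klFun (p ω)) ∂ν :=
    klDiv_eq_lintegral_klFun_of_ac hP
  have hkQ : klDiv (Q : Measure Ω) ν = ∫⁻ ω, ENNReal.ofReal (klFun (q ω)) ∂ν :=
    klDiv_eq_lintegral_klFun_of_ac hQ
  have hs1 : ENNReal.ofReal s = ∫⁻ ω, ENNReal.ofReal (s / 2) *
      (ENNReal.ofReal (p ω) + ENNReal.ofReal (q ω)) ∂ν := by
    rw [lintegral_const_mul _ (by fun_prop), lintegral_add_left (by fun_prop),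
      lintegral_ofReal_rnDensity P hP, lintegral_ofReal_rnDensity Q hQ, one_add_one_eq_two,
      ← ENNReal.ofReal_ofNat, ← ENNReal.ofReal_mul (by positivity)]
    congr 1
    ring
  rw [hM, hkP, hkQ, hs1, eLpNorm_one_eq_lintegral_enorm, ← lintegral_const_mul _ (by fun_prop),
    ← lintegral_add_left (hpm.sub hqm).enorm, ← lintegral_add_left (by fun_prop),
    ← lintegral_const_mul _ (by fun_prop), ← lintegral_add_left (by fun_prop)]
  refine lintegral_mono fun ω => ?_
  have h := abs_sub_add_klFun_midpoint_le (hp0 ω) (hq0 ω) hs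
  have k1 := klFun_nonneg (hp0 ω)
  have k2 := klFun_nonneg (hq0 ω)
  have k3 : 0 ≤ klFun ((p ω + q ω) / 2) :=
    klFun_nonneg (div_nonneg (add_nonneg (hp0 ω) (hq0 ω)) zero_le_two)
  simp only [Pi.sub_apply]
  rw [Real.enorm_eq_ofReal_abs, ← ENNReal.ofReal_mul (by positivity),
    ← ENNReal.ofReal_add (abs_nonneg _) (by positivity), ← ENNReal.ofReal_add k1 k2,
    ← ENNReal.ofReal_add (hp0 ω) (hq0 ω), ← ENNReal.ofReal_mul (by positivity),
    ← ENNReal.ofReal_mul (by positivity),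
    ← ENNReal.ofReal_add (by positivity) (mul_nonneg (by positivity) (add_nonneg (hp0 ω) (hq0 ω)))]
  exact ENNReal.ofReal_le_ofReal h

end KLDiv

/-! ### The entropy computed with an admissible weight, as a real number -/

section WeightedEntropy

variable {Ω : Type*} [MeasurableSpace Ω]

/-- The number `entropyWith R W P` computed in `ℝ`. It agrees with `entropyWith R W P` as soon as
the divergence in it is finite. -/
def realEntropyWith (R : Measure Ω) (W : Ω → ℝ≥0) (P : ProbabilityMeasure Ω) : ℝ :=
  (klDiv (P : Measure Ω) (R.tilted fun ω => -(W ω : ℝ))).toReal - ∫ ω, (W ω : ℝ) ∂(P : Measure Ω)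
    - Real.log (∫ ω, Real.exp (-(W ω : ℝ)) ∂ R)

/-- The weight `W` is `P`-integrable and `P` has finite divergence from the tilted measure `R_W`.
-/
structure HasFiniteEntropyWith (R : Measure Ω) (W : Ω → ℝ≥0) (P : ProbabilityMeasure Ω) :
    Prop where
  lintegral_lt_top : ∫⁻ ω, (W ω : ℝ≥0∞) ∂(P : Measure Ω) < ∞
  klDiv_ne_top : klDiv (P : Measure Ω) (R.tilted fun ω => -(W ω : ℝ)) ≠ ∞

theorem integral_coe_eq_toReal_lintegral {W : Ω → ℝ≥0} (hW : Measurable W) (P : Measure Ω) :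
    ∫ ω, (W ω : ℝ) ∂P = (∫⁻ ω, (W ω : ℝ≥0∞) ∂P).toReal :=
  integral_toReal (f := fun ω => (W ω : ℝ≥0∞)) hW.coe_nnreal_ennreal.aemeasurable (by simp)

theorem entropyWith_eq_coe {R : Measure Ω} {W : Ω → ℝ≥0} {P : ProbabilityMeasure Ω}
    (h : klDiv (P : Measure Ω) (R.tilted fun ω => -(W ω : ℝ)) ≠ ∞) :
    entropyWith R W P = realEntropyWith R W P := by
  rw [entropyWith, realEntropyWith, EReal.coe_sub, EReal.coe_sub, EReal.coe_ennreal_toReal h]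

theorem entropyWith_lt_top_iff {R : Measure Ω} {W : Ω → ℝ≥0} {P : ProbabilityMeasure Ω} :
    entropyWith R W P < ⊤ ↔ klDiv (P : Measure Ω) (R.tilted fun ω => -(W ω : ℝ)) ≠ ∞ := by
  refine ⟨fun h htop => ?_, fun h => ?_⟩
  · rw [entropyWith, htop] at h
    simp at h
  · rw [entropyWith_eq_coe h]
    exact EReal.coe_lt_top _

namespace HasFiniteEntropyWith

variable {R : Measure Ω} {W : Ω → ℝ≥0} {P Q : ProbabilityMeasure Ω}

theorem relEntropy_eq [SigmaFinite R] (h : HasFiniteEntropyWith R W P)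
    (hW : IsEntropyWeight R W) : relEntropy P R = realEntropyWith R W P := by
  rw [relEntropy_eq_entropyWith R P hW h.lintegral_lt_top, entropyWith_eq_coe h.klDiv_ne_top]

theorem absolutelyContinuous_tilted (h : HasFiniteEntropyWith R W P) :
    (P : Measure Ω) ≪ R.tilted fun ω => -(W ω : ℝ) :=
  (klDiv_ne_top_iff.1 h.klDiv_ne_top).1

theorem absolutelyContinuous (h : HasFiniteEntropyWith R W P) : (P : Measure Ω) ≪ R :=
  h.absolutelyContinuous_tilted.trans (tilted_absolutelyContinuous R _)

theorem isProbabilityMeasure_tilted (h : HasFiniteEntropyWith R W P) (hW : IsEntropyWeight R W) :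
    IsProbabilityMeasure (R.tilted fun ω => -(W ω : ℝ)) := by
  have : NeZero R := ⟨by
    rintro rfl
    exact IsProbabilityMeasure.ne_zero (P : Measure Ω)
      (Measure.absolutelyContinuous_zero_iff.1 h.absolutelyContinuous)⟩
  exact MeasureTheory.isProbabilityMeasure_tilted hW.integrable

theorem halfSum (hP : HasFiniteEntropyWith R W P) (hQ : HasFiniteEntropyWith R W Q)
    (hW : IsEntropyWeight R W) : HasFiniteEntropyWith R W (halfSum P Q) where
  lintegral_lt_top := by
    rw [coe_halfSum, lintegral_smul_measure, lintegral_add_measure]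
    exact ENNReal.mul_lt_top (by simp) (ENNReal.add_lt_top.2
      ⟨hP.lintegral_lt_top, hQ.lintegral_lt_top⟩)
  klDiv_ne_top := by
    have := hP.isProbabilityMeasure_tilted hW
    have h := eLpNorm_rnDensity_sub_add_klDiv_halfSum_le hP.absolutelyContinuous_tilted
      hQ.absolutelyContinuous_tilted one_pos
    intro htop
    rw [htop, ENNReal.mul_top (by simp)] at h
    have h2 : ENNReal.ofReal (2 / 1) * (klDiv (P : Measure Ω) (R.tilted fun ω => -(W ω : ℝ)) +
        klDiv (Q : Measure Ω) (R.tilted fun ω => -(W ω : ℝ))) + ENNReal.ofReal 1 ≠ ∞ :=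
      ENNReal.add_ne_top.2 ⟨ENNReal.mul_ne_top ENNReal.ofReal_ne_top
        (ENNReal.add_ne_top.2 ⟨hP.klDiv_ne_top, hQ.klDiv_ne_top⟩), ENNReal.ofReal_ne_top⟩
    exact h2 (top_le_iff.1 (by simpa using h))

/-- The term `∫ W dP` is affine in `P`, so the convexity defect of the entropy is that of the
divergence and controls the `L¹` distance of the densities. -/
theorem eLpNorm_rnDensity_sub_le (hP : HasFiniteEntropyWith R W P)
    (hQ : HasFiniteEntropyWith R W Q) (hW : IsEntropyWeight R W) {s : ℝ} (hs : 0 < s) :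
    eLpNorm (rnDensity (P : Measure Ω) (R.tilted fun ω => -(W ω : ℝ)) -
        rnDensity (Q : Measure Ω) (R.tilted fun ω => -(W ω : ℝ))) 1
        (R.tilted fun ω => -(W ω : ℝ)) ≤
      ENNReal.ofReal (2 / s * (realEntropyWith R W P + realEntropyWith R W Q -
        2 * realEntropyWith R W (_root_.halfSum P Q)) + s) := by
  have := hP.isProbabilityMeasure_tilted hW
  have h := eLpNorm_rnDensity_sub_add_klDiv_halfSum_le hP.absolutelyContinuous_tilted
    hQ.absolutelyContinuous_tilted hs
  have hM := hP.halfSum hQ hW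
  have hw : ∫ ω, (W ω : ℝ) ∂(_root_.halfSum P Q : Measure Ω) =
      (∫ ω, (W ω : ℝ) ∂(P : Measure Ω) + ∫ ω, (W ω : ℝ) ∂(Q : Measure Ω)) / 2 := by
    simp only [integral_coe_eq_toReal_lintegral hW.measurable]
    rw [coe_halfSum, lintegral_smul_measure, lintegral_add_measure, smul_eq_mul,
      ENNReal.toReal_mul, ENNReal.toReal_add hP.lintegral_lt_top.ne hQ.lintegral_lt_top.ne]
    simp
    ring
  rw [← ENNReal.ofReal_toReal hP.klDiv_ne_top, ← ENNReal.ofReal_toReal hQ.klDiv_ne_top,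
    ← ENNReal.ofReal_toReal hM.klDiv_ne_top,
    ← ENNReal.ofReal_add ENNReal.toReal_nonneg ENNReal.toReal_nonneg,
    ← ENNReal.ofReal_mul (by positivity), ← ENNReal.ofReal_mul (by positivity),
    ← ENNReal.ofReal_add (by positivity) hs.le] at h
  refine (ENNReal.le_sub_of_add_le_right ENNReal.ofReal_ne_top h).trans ?_
  rw [← ENNReal.ofReal_sub _ (by positivity)]
  refine ENNReal.ofReal_le_ofReal (le_of_eq ?_)
  simp only [realEntropyWith, hw]
  ring

end HasFiniteEntropyWith

theorem exists_isEntropyWeight_of_relEntropy_lt_top {R : Measure Ω} {P : ProbabilityMeasure Ω}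
    (h : relEntropy P R < ⊤) :
    ∃ W, IsEntropyWeight R W ∧ ∫⁻ ω, (W ω : ℝ≥0∞) ∂(P : Measure Ω) < ∞ := by
  by_contra hne
  rw [relEntropy, dif_neg hne] at h
  exact lt_irrefl _ h

theorem hasFiniteEntropyWith_of_relEntropy_lt_top {R : Measure Ω} [SigmaFinite R] {W : Ω → ℝ≥0}
    {P : ProbabilityMeasure Ω} (h : relEntropy P R < ⊤) (hW : IsEntropyWeight R W)
    (hWP : ∫⁻ ω, (W ω : ℝ≥0∞) ∂(P : Measure Ω) < ∞) : HasFiniteEntropyWith R W P := by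
  rw [relEntropy_eq_entropyWith R P hW hWP, entropyWith_lt_top_iff] at h
  exact ⟨hWP, h⟩

theorem absolutelyContinuous_of_relEntropy_lt_top {R : Measure Ω} [SigmaFinite R]
    {P : ProbabilityMeasure Ω} (h : relEntropy P R < ⊤) : (P : Measure Ω) ≪ R := by
  obtain ⟨W, hW, hWP⟩ := exists_isEntropyWeight_of_relEntropy_lt_top h
  exact (hasFiniteEntropyWith_of_relEntropy_lt_top h hW hWP).absolutelyContinuous

/-- The minimum of two weights is integrable against every probability measure for which one of
the two weights is. -/
theorem isEntropyWeight_min {R : Measure Ω} {W V : Ω → ℝ≥0} (hW : IsEntropyWeight R W)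
    (hV : IsEntropyWeight R V) : IsEntropyWeight R fun ω => min (W ω) (V ω) where
  measurable := hW.measurable.min hV.measurable
  integrable := by
    have hm : Measurable fun ω => min (W ω) (V ω) := hW.measurable.min hV.measurable
    refine (hW.integrable.add hV.integrable).mono'
      (Real.measurable_exp.comp hm.coe_nnreal_real.neg).aestronglyMeasurable
      (Filter.Eventually.of_forall fun ω => ?_)
    simp only [Pi.add_apply, Real.norm_eq_abs, Real.abs_exp]
    rcases min_choice (W ω) (V ω) with h | h <;> rw [h]
    · linarith [Real.exp_pos (-(V ω : ℝ))]
    · linarith [Real.exp_pos (-(W ω : ℝ))]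

/-- Strict convexity of the relative entropy: two measures of the same entropy, which is at most
the entropy of their midpoint, are equal. -/
theorem eq_of_relEntropy_le_relEntropy_halfSum {R : Measure Ω} [SigmaFinite R]
    {P Q : ProbabilityMeasure Ω} (hP : relEntropy P R < ⊤) (hPQ : relEntropy P R = relEntropy Q R)
    (hM : relEntropy P R ≤ relEntropy (halfSum P Q) R) : P = Q := by
  obtain ⟨W, hW, hWP⟩ := exists_isEntropyWeight_of_relEntropy_lt_top hP
  obtain ⟨V, hV, hVQ⟩ := exists_isEntropyWeight_of_relEntropy_lt_top (hPQ ▸ hP)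
  have hU := isEntropyWeight_min hW hV
  have hP' := hasFiniteEntropyWith_of_relEntropy_lt_top hP hU
    ((lintegral_mono fun ω => ENNReal.coe_le_coe.2 (min_le_left _ _)).trans_lt hWP)
  have hQ' := hasFiniteEntropyWith_of_relEntropy_lt_top (hPQ ▸ hP) hU
    ((lintegral_mono fun ω => ENNReal.coe_le_coe.2 (min_le_right _ _)).trans_lt hVQ)
  have := hP'.isProbabilityMeasure_tilted hU
  rw [hP'.relEntropy_eq hU, hQ'.relEntropy_eq hU, EReal.coe_eq_coe_iff] at hPQ
  rw [hP'.relEntropy_eq hU, (hP'.halfSum hQ' hU).relEntropy_eq hU, EReal.coe_le_coe_iff] at hM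
  have h0 : eLpNorm (rnDensity (P : Measure Ω) (R.tilted fun ω => -(↑(min (W ω) (V ω)) : ℝ)) -
      rnDensity (Q : Measure Ω) (R.tilted fun ω => -(↑(min (W ω) (V ω)) : ℝ))) 1
      (R.tilted fun ω => -(↑(min (W ω) (V ω)) : ℝ)) = 0 := by
    refine le_antisymm (ENNReal.le_of_forall_pos_le_add fun ε hε _ => ?_) zero_le
    have hε' : (0 : ℝ) < ε := hε
    refine (hP'.eLpNorm_rnDensity_sub_le hQ' hU hε').trans ?_
    rw [zero_add, ← ENNReal.ofReal_coe_nnreal]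
    refine ENNReal.ofReal_le_ofReal ?_
    have : 2 / (ε : ℝ) * (realEntropyWith R (fun ω => min (W ω) (V ω)) P +
        realEntropyWith R (fun ω => min (W ω) (V ω)) Q -
        2 * realEntropyWith R (fun ω => min (W ω) (V ω)) (halfSum P Q)) ≤ 0 :=
      mul_nonpos_of_nonneg_of_nonpos (by positivity) (by linarith)
    linarith
  refine Subtype.ext (Measure.ext fun A hA => le_antisymm ?_ ?_)
  · have h := measure_le_add_eLpNorm_rnDensity_sub hP'.absolutelyContinuous_tilted
      hQ'.absolutelyContinuous_tilted hA
    rwa [h0, add_zero] at h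
  · have h := measure_le_add_eLpNorm_rnDensity_sub hQ'.absolutelyContinuous_tilted
      hP'.absolutelyContinuous_tilted hA
    rwa [eLpNorm_sub_comm, h0, add_zero] at h

end WeightedEntropy

/-! ### Existence of an entropy minimizer -/

section Existence

variable {Ω : Type*} [MeasurableSpace Ω]

theorem lintegral_le_lintegral_min_add {W : Ω → ℝ≥0} (hW : Measurable W) (P : Measure Ω)
    (K : ℝ≥0) : ∫⁻ ω, (W ω : ℝ≥0∞) ∂P ≤
      ∫⁻ ω, ((min (W ω) K : ℝ≥0) : ℝ≥0∞) ∂P + ∫⁻ ω in {ω | K ≤ W ω}, (W ω : ℝ≥0∞) ∂P := by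
  have hA : MeasurableSet {ω | K ≤ W ω} := measurableSet_le measurable_const hW
  rw [← lintegral_indicator hA, ← lintegral_add_left (hW.min measurable_const).coe_nnreal_ennreal]
  refine lintegral_mono fun ω => ?_
  by_cases h : K ≤ W ω
  · rw [Set.indicator_of_mem (show ω ∈ {ω | K ≤ W ω} from h)]
    exact le_add_self
  · rw [min_eq_left (not_le.1 h).le]
    exact le_self_add

namespace UniformlyIntegrableOver

variable {W : Ω → ℝ≥0} {S : Set (ProbabilityMeasure Ω)}

theorem exists_lintegral_le (hUI : UniformlyIntegrableOver W S) (hW : Measurable W) :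
    ∃ C : ℝ≥0, ∀ P ∈ S, ∫⁻ ω, (W ω : ℝ≥0∞) ∂(P : Measure Ω) ≤ C := by
  obtain ⟨K, hK⟩ := hUI 1 one_pos
  refine ⟨K + 1, fun P hP => (lintegral_le_lintegral_min_add hW P K).trans ?_⟩
  rw [ENNReal.coe_add]
  refine add_le_add ?_ (hK P hP)
  calc ∫⁻ ω, ((min (W ω) K : ℝ≥0) : ℝ≥0∞) ∂(P : Measure Ω)
      ≤ ∫⁻ _, (K : ℝ≥0∞) ∂(P : Measure Ω) :=
        lintegral_mono fun ω => ENNReal.coe_le_coe.2 (min_le_right _ _)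
    _ = K := by simp

/-- Uniform integrability makes `P ↦ ∫ W dP` upper semicontinuous along sequences whose densities
converge in `L¹`. -/
theorem eventually_lintegral_le (hUI : UniformlyIntegrableOver W S) (hW : Measurable W)
    {ν : Measure Ω} [SigmaFinite ν] {P : ℕ → ProbabilityMeasure Ω} {Q : ProbabilityMeasure Ω}
    (hPS : ∀ n, P n ∈ S) (hP : ∀ n, (P n : Measure Ω) ≪ ν) (hQ : (Q : Measure Ω) ≪ ν)
    (h : Filter.Tendsto
      (fun n => eLpNorm (rnDensity (P n : Measure Ω) ν - rnDensity (Q : Measure Ω) ν) 1 ν)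
      Filter.atTop (nhds 0)) {ε : ℝ≥0} (hε : 0 < ε) :
    ∀ᶠ n in Filter.atTop, ∫⁻ ω, (W ω : ℝ≥0∞) ∂(P n : Measure Ω) ≤
      ∫⁻ ω, (W ω : ℝ≥0∞) ∂(Q : Measure Ω) + ε := by
  obtain ⟨K, hK⟩ := hUI (ε / 2) (half_pos hε)
  have hlim : Filter.Tendsto (fun n => (K : ℝ≥0∞) *
      eLpNorm (rnDensity (P n : Measure Ω) ν - rnDensity (Q : Measure Ω) ν) 1 ν)
      Filter.atTop (nhds 0) := by
    simpa using ENNReal.Tendsto.const_mul h (Or.inr ENNReal.coe_ne_top)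
  filter_upwards [hlim.eventually_le_const
    (show (0 : ℝ≥0∞) < ((ε / 2 : ℝ≥0) : ℝ≥0∞) from ENNReal.coe_pos.2 (half_pos hε))] with n hn
  have h1 := lintegral_le_add_mul_eLpNorm_rnDensity_sub (hP n) hQ
    (hW.min measurable_const).coe_nnreal_ennreal (K := K)
    (fun ω => ENNReal.coe_le_coe.2 (min_le_right (W ω) K))
  calc ∫⁻ ω, (W ω : ℝ≥0∞) ∂(P n : Measure Ω)
      ≤ (∫⁻ ω, ((min (W ω) K : ℝ≥0) : ℝ≥0∞) ∂(Q : Measure Ω) + ((ε / 2 : ℝ≥0) : ℝ≥0∞)) +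
          ((ε / 2 : ℝ≥0) : ℝ≥0∞) :=
        (lintegral_le_lintegral_min_add hW _ K).trans
          (add_le_add (h1.trans (add_le_add le_rfl hn)) (hK _ (hPS n)))
    _ = ∫⁻ ω, ((min (W ω) K : ℝ≥0) : ℝ≥0∞) ∂(Q : Measure Ω) + ε := by
        rw [add_assoc, ← ENNReal.coe_add, add_halves]
    _ ≤ _ := by
        gcongr
        exact min_le_left _ _

end UniformlyIntegrableOver

/-- Lower semicontinuity of the entropy along sequences in `S` whose densities converge in `L¹`. -/
theorem realEntropyWith_le_of_tendsto {R : Measure Ω} {W : Ω → ℝ≥0} (hW : IsEntropyWeight R W)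
    {S : Set (ProbabilityMeasure Ω)} (hUI : UniformlyIntegrableOver W S)
    {P : ℕ → ProbabilityMeasure Ω} {Q : ProbabilityMeasure Ω} (hPS : ∀ n, P n ∈ S)
    (hP : ∀ n, HasFiniteEntropyWith R W (P n))
    (hQ : (Q : Measure Ω) ≪ R.tilted fun ω => -(W ω : ℝ))
    (hWQ : ∫⁻ ω, (W ω : ℝ≥0∞) ∂(Q : Measure Ω) < ∞)
    (h : Filter.Tendsto (fun n => eLpNorm
        (rnDensity (P n : Measure Ω) (R.tilted fun ω => -(W ω : ℝ)) -
          rnDensity (Q : Measure Ω) (R.tilted fun ω => -(W ω : ℝ))) 1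
          (R.tilted fun ω => -(W ω : ℝ))) Filter.atTop (nhds 0)) {m : ℝ}
    (hm : ∀ ε > 0, ∀ᶠ n in Filter.atTop, realEntropyWith R W (P n) ≤ m + ε) :
    HasFiniteEntropyWith R W Q ∧ realEntropyWith R W Q ≤ m := by
  have := (hP 0).isProbabilityMeasure_tilted hW
  set ν := R.tilted fun ω => -(W ω : ℝ) with hν
  set z := Real.log (∫ ω, Real.exp (-(W ω : ℝ)) ∂ R) with hz
  have key : ∀ ε : ℝ≥0, 0 < ε → klDiv (Q : Measure Ω) ν ≠ ∞ ∧
      realEntropyWith R W Q ≤ m + ε + ε := by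
    intro ε hε
    have hev : ∀ᶠ n in Filter.atTop, (klDiv (P n : Measure Ω) ν).toReal ≤
        m + ε + (∫ ω, (W ω : ℝ) ∂(Q : Measure Ω) + ε) + z := by
      filter_upwards [hm ε hε, hUI.eventually_lintegral_le hW.measurable hPS
        (fun n => (hP n).absolutelyContinuous_tilted) hQ h hε] with n h1 h2
      have h3 : ∫ ω, (W ω : ℝ) ∂(P n : Measure Ω) ≤ ∫ ω, (W ω : ℝ) ∂(Q : Measure Ω) + ε := by
        simp only [integral_coe_eq_toReal_lintegral hW.measurable]
        rw [← ENNReal.coe_toReal ε, ← ENNReal.toReal_add hWQ.ne ENNReal.coe_ne_top]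
        exact ENNReal.toReal_mono (ENNReal.add_ne_top.2 ⟨hWQ.ne, ENNReal.coe_ne_top⟩) h2
      rw [realEntropyWith] at h1
      linarith
    obtain ⟨n, hn⟩ := hev.exists
    have hle := klDiv_le_of_tendsto_eLpNorm_rnDensity_sub
      (fun n => (hP n).absolutelyContinuous_tilted) hQ h
      (hev.mono fun n hn => ENNReal.le_ofReal_iff_toReal_le (hP n).klDiv_ne_top
        (ENNReal.toReal_nonneg.trans hn) |>.2 hn)
    have h4 := ENNReal.toReal_le_of_le_ofReal (ENNReal.toReal_nonneg.trans hn) hle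
    refine ⟨ne_top_of_le_ne_top ENNReal.ofReal_ne_top hle, ?_⟩
    rw [realEntropyWith]
    linarith
  refine ⟨⟨hWQ, (key 1 one_pos).1⟩, le_of_forall_pos_le_add fun ε hε => ?_⟩
  have h5 := (key (ε / 2).toNNReal (Real.toNNReal_pos.2 (half_pos hε))).2
  rw [Real.coe_toNNReal _ (half_pos hε).le] at h5
  linarith

/-- Existence of an entropy minimizer in a set of probability measures which is stable under
midpoints and setwise limits, when a weight is uniformly integrable over it. -/
theorem exists_relEntropy_minimizer {R : Measure Ω} [SigmaFinite R] {W : Ω → ℝ≥0}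
    (hW : IsEntropyWeight R W) {S : Set (ProbabilityMeasure Ω)}
    (hmid : ∀ P ∈ S, ∀ Q ∈ S, halfSum P Q ∈ S)
    (hclosed : ∀ (P : ℕ → ProbabilityMeasure Ω) (Q : ProbabilityMeasure Ω), (∀ n, P n ∈ S) →
      (∀ A, MeasurableSet A → Filter.Tendsto (fun n => (P n : Measure Ω) A) Filter.atTop
        (nhds ((Q : Measure Ω) A))) → Q ∈ S)
    (hUI : UniformlyIntegrableOver W {P ∈ S | (P : Measure Ω) ≪ R})
    (hne : ∃ Q ∈ S, relEntropy Q R < ⊤) :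
    ∃ P ∈ S, relEntropy P R < ⊤ ∧ ∀ P' ∈ S, relEntropy P R ≤ relEntropy P' R := by
  obtain ⟨C, hC⟩ := hUI.exists_lintegral_le hW.measurable
  have hfin : ∀ P ∈ S, relEntropy P R < ⊤ → HasFiniteEntropyWith R W P := fun P hP h =>
    hasFiniteEntropyWith_of_relEntropy_lt_top h hW
      ((hC P ⟨hP, absolutelyContinuous_of_relEntropy_lt_top h⟩).trans_lt ENNReal.coe_lt_top)
  obtain ⟨Q₀, hQ₀S, hQ₀⟩ := hne
  have := (hfin Q₀ hQ₀S hQ₀).isProbabilityMeasure_tilted hW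
  set ν := R.tilted fun ω => -(W ω : ℝ) with hν
  set E : Set ℝ := realEntropyWith R W '' {P ∈ S | HasFiniteEntropyWith R W P} with hE
  have hEne : E.Nonempty := ⟨_, Q₀, ⟨hQ₀S, hfin Q₀ hQ₀S hQ₀⟩, rfl⟩
  have hEbdd : BddBelow E := by
    refine ⟨-C - Real.log (∫ ω, Real.exp (-(W ω : ℝ)) ∂ R), ?_⟩
    rintro _ ⟨P, ⟨hPS, hP⟩, rfl⟩
    have h1 : ∫ ω, (W ω : ℝ) ∂(P : Measure Ω) ≤ C := by
      rw [integral_coe_eq_toReal_lintegral hW.measurable]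
      exact ENNReal.toReal_le_coe_of_le_coe (hC P ⟨hPS, hP.absolutelyContinuous⟩)
    have h2 : 0 ≤ (klDiv (P : Measure Ω) ν).toReal := ENNReal.toReal_nonneg
    rw [realEntropyWith]
    linarith
  have hlow : ∀ P ∈ S, HasFiniteEntropyWith R W P → sInf E ≤ realEntropyWith R W P :=
    fun P hPS hP => csInf_le hEbdd ⟨P, ⟨hPS, hP⟩, rfl⟩
  -- The tolerance is such that the convexity estimate with `s = 2⁻ⁿ / 4` bounds the `L¹` distance
  -- of two later terms by `2⁻ⁿ / 2`, which is summable.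
  have hseq : ∀ n : ℕ, ∃ P, (P ∈ S ∧ HasFiniteEntropyWith R W P) ∧
      realEntropyWith R W P < sInf E + ((1 / 2 : ℝ) ^ n) ^ 2 / 64 := fun n => by
    obtain ⟨_, ⟨P, hP, rfl⟩, hlt⟩ := exists_lt_of_csInf_lt hEne
      (show sInf E < sInf E + ((1 / 2 : ℝ) ^ n) ^ 2 / 64 by
        have : (0 : ℝ) < ((1 / 2 : ℝ) ^ n) ^ 2 / 64 := by positivity
        linarith)
    exact ⟨P, hP, hlt⟩
  choose P hPS' hPlt using hseq
  have hPS : ∀ n, P n ∈ S := fun n => (hPS' n).1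
  have hP : ∀ n, HasFiniteEntropyWith R W (P n) := fun n => (hPS' n).2
  have hPε : ∀ N n, N ≤ n → realEntropyWith R W (P n) < sInf E + ((1 / 2 : ℝ) ^ N) ^ 2 / 64 := by
    intro N n hNn
    refine (hPlt n).trans_le ?_
    have : (1 / 2 : ℝ) ^ n ≤ (1 / 2) ^ N := pow_le_pow_of_le_one (by norm_num) (by norm_num) hNn
    gcongr
  obtain ⟨Q, hQν, hlim⟩ := exists_tendsto_eLpNorm_rnDensity_sub
    (fun n => (hP n).absolutelyContinuous_tilted) (B := fun n => ENNReal.ofReal ((1 / 2 : ℝ) ^ n))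
    (by
      rw [← ENNReal.ofReal_tsum_of_nonneg (fun n => by positivity) summable_geometric_two]
      exact ENNReal.ofReal_ne_top)
    (by
      intro N n k hn hk
      set δ : ℝ := (1 / 2) ^ N with hδ
      have hδ0 : 0 < δ := by positivity
      have hb := (hP n).eLpNorm_rnDensity_sub_le (hP k) hW (s := δ / 4) (by positivity)
      refine hb.trans_lt ((ENNReal.ofReal_lt_ofReal_iff hδ0).2 ?_)
      have h1 := hPε N n hn
      have h2 := hPε N k hk
      have h3 := hlow _ (hmid _ (hPS n) _ (hPS k)) ((hP n).halfSum (hP k) hW)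
      -- Both entropies exceed the infimum by at most `δ² / 64`, and the midpoint's is not below it.
      have h4 : 2 / (δ / 4) * (realEntropyWith R W (P n) + realEntropyWith R W (P k) -
          2 * realEntropyWith R W (halfSum (P n) (P k))) ≤ 2 / (δ / 4) * (δ ^ 2 / 32) :=
        mul_le_mul_of_nonneg_left (by linarith) (by positivity)
      have h5 : 2 / (δ / 4) * (δ ^ 2 / 32) = δ / 4 := by field_simp; norm_num
      linarith)
  have hQS : Q ∈ S := hclosed P Q hPS fun A hA =>
    tendsto_measure_of_tendsto_eLpNorm_rnDensity_sub
      (fun n => (hP n).absolutelyContinuous_tilted) hQν hlim hA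
  have hQR : (Q : Measure Ω) ≪ R := hQν.trans (tilted_absolutelyContinuous R _)
  obtain ⟨hQfin, hQle⟩ := realEntropyWith_le_of_tendsto hW hUI (m := sInf E)
    (fun n => ⟨hPS n, (hP n).absolutelyContinuous⟩) hP hQν
    ((hC Q ⟨hQS, hQR⟩).trans_lt ENNReal.coe_lt_top) hlim (fun ε hε => by
      have ht : Filter.Tendsto (fun n : ℕ => ((1 / 2 : ℝ) ^ n) ^ 2 / 64) Filter.atTop (nhds 0) := by
        simpa using ((tendsto_pow_atTop_nhds_zero_of_lt_one (r := (1 / 2 : ℝ)) (by norm_num)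
          (by norm_num)).pow 2).div_const 64
      filter_upwards [ht.eventually_le_const hε] with n hn
      linarith [hPlt n])
  refine ⟨Q, hQS, ?_, fun P' hP' => ?_⟩
  · rw [hQfin.relEntropy_eq hW]
    exact EReal.coe_lt_top _
  · rcases eq_or_ne (relEntropy P' R) ⊤ with htop | htop
    · rw [htop]
      exact le_top
    · have hP'fin := hfin P' hP' (lt_top_iff_ne_top.2 htop)
      rw [hQfin.relEntropy_eq hW, hP'fin.relEntropy_eq hW, EReal.coe_le_coe_iff]
      exact hQle.trans (hlow P' hP' hP'fin)

end Existence

/-! ### Competitors of the extended Schrödinger problem -/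

section Competitors

variable {X : Type*} [TopologicalSpace X] [MeasurableSpace X] [BorelSpace X]

theorem PathSpace.measurable_eval (t : unitInterval) :
    Measurable fun ω : PathSpace X => ω t :=
  (continuous_eval_const t).measurable

theorem IsConditionable.sigmaFinite {R : Measure (PathSpace X)} (hR : IsConditionable R) :
    SigmaFinite R :=
  SigmaFinite.of_map R (PathSpace.measurable_eval 0).aemeasurable (hR 0)

variable {T : Set unitInterval} {μ : T → ProbabilityMeasure X}

theorem halfSum_mem_competitors {P Q : ProbabilityMeasure (PathSpace X)}
    (hP : P ∈ competitors T μ) (hQ : Q ∈ competitors T μ) : halfSum P Q ∈ competitors T μ := by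
  intro t
  have h1 := hP t
  have h2 := hQ t
  rw [timeMarginal] at h1 h2 ⊢
  rw [coe_halfSum, Measure.map_smul, Measure.map_add _ _ (PathSpace.measurable_eval _), h1, h2,
    ← two_smul ℝ≥0∞, smul_smul, ENNReal.inv_mul_cancel two_ne_zero ENNReal.ofNat_ne_top, one_smul]

theorem mem_competitors_of_tendsto {P : ℕ → ProbabilityMeasure (PathSpace X)}
    {Q : ProbabilityMeasure (PathSpace X)} (hP : ∀ n, P n ∈ competitors T μ)
    (h : ∀ A, MeasurableSet A → Filter.Tendsto (fun n => (P n : Measure (PathSpace X)) A)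
      Filter.atTop (nhds ((Q : Measure (PathSpace X)) A))) : Q ∈ competitors T μ := by
  intro t
  ext B hB
  have hm := PathSpace.measurable_eval (X := X) t
  have hc : ∀ n, (P n : Measure (PathSpace X)) ((fun ω => ω t) ⁻¹' B) = (μ t : Measure X) B :=
    fun n => by rw [← hP n t, timeMarginal, Measure.map_apply hm hB]
  have hlim := h _ (hm hB)
  simp only [hc] at hlim
  rw [timeMarginal, Measure.map_apply hm hB]
  exact tendsto_nhds_unique hlim tendsto_const_nhds

end Competitors

end

theorem mainTheorem9 {X : Type*} [TopologicalSpace X] [PolishSpace X] [MeasurableSpace X]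
    [BorelSpace X] (R : Measure (PathSpace X)) (hR : IsConditionable R)
    (T : Set unitInterval) (μ : T → ProbabilityMeasure X) :
    ((∃ W : PathSpace X → ℝ≥0, IsEntropyWeight R W ∧
        UniformlyIntegrableOver W {P ∈ competitors T μ | (P : Measure (PathSpace X)) ≪ R}) →
      ((∃ P, IsSchrodingerSolution R T μ P) ↔ ∃ Q ∈ competitors T μ, relEntropy Q R < ⊤)) ∧
    (∀ P P', IsSchrodingerSolution R T μ P → IsSchrodingerSolution R T μ P' → P = P') := by
  have := hR.sigmaFinite
  refine ⟨?_, fun P P' hP hP' => ?_⟩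
  · rintro ⟨W, hW, hUI⟩
    refine ⟨fun ⟨P, hP⟩ => ⟨P, hP.mem, hP.lt_top⟩, fun hne => ?_⟩
    obtain ⟨P, hPS, hlt, hle⟩ := exists_relEntropy_minimizer hW
      (fun P hP Q hQ => halfSum_mem_competitors hP hQ)
      (fun P Q hP h => mem_competitors_of_tendsto hP h) hUI hne
    exact ⟨P, hPS, hlt, hle⟩
  · exact eq_of_relEntropy_le_relEntropy_halfSum hP.lt_top
      (le_antisymm (hP.le P' hP'.mem) (hP'.le P hP.mem))
      (hP.le _ (halfSum_mem_competitors hP.mem hP'.mem))
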